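/- For each $n$ let $M_n(\mathbb C)$ carry the operator norm, let $A=\begin{pmatrix}1&1\\0&0\end{pmatrix}$, and let $\mathcal D_{\mathcal L}=(\mathcal D_{\mathcal L}(n))_n$ be the one-variable LMI domain $$\mathcal D_{\mathcal L}(n)=\{X\in M_n(\mathbb C): I_2\otimes I_n+A\otimes X+A^*\otimes X^*\succ0\}.$$ A free self-map $f$ of $\mathcal D_{\mathcal L}$ is a sequence of functions $f[n]:\mathcal D_{\mathcal L}(n)\to\mathcal D_{\mathcal L}(n)$ such that $f[n](X)\Gamma=\Gamma f[m](Y)$ whenever $X\in\mathcal D_{\mathcal L}(n)$, $Y\in\mathcal D_{\mathcal L}(m)$, $\Gamma\in\mathbb C^{n\times m}$ and $X\Gamma=\Gamma Y$. It is continuous (analytic) if each $f[n]$ is continuous (analytic), and proper if, for each $n$, the preimage under $f[n]$ of every compact subset of $\mathcal D_{\mathcal L}(n)$ is compact. Then $\mathcal D_{\mathcal L}(n)=\{X\in M_n(\mathbb C):\|X-1\|<\sqrt2\}$ for every $n$, and the following hold. (1) For every real $\theta$ and every $X\in\mathcal D_{\mathcal L}(n)$ the matrix $1+X-e^{i\theta}X$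 is invertible, and $f_\theta(X)=e^{i\theta}X(1+X-e^{i\theta}X)^{-1}$ defines a proper continuous (indeed analytic) free self-map of $\mathcal D_{\mathcal L}$ with $f_\theta(0)=0$ and $f_\theta'(0)=e^{i\theta}$, that is, the derivative of $f_\theta[n]$ at $0$ is $H\mapsto e^{i\theta}H$ for every $n$. (2) If $f$ is a proper continuous free self-map of $\mathcal D_{\mathcal L}$ with $f(0)=0$, then there is a real $\theta$ such that $f=f_\theta$, that is, $f[n](X)=f_\theta(X)$ for all $n$ and all $X\in\mathcal D_{\mathcal L}(n)$. -/

import Mathlib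

open scoped Matrix Kronecker Matrix.Norms.L2Operator ComplexOrder

namespace FreeMap

/-- The space of `n × n` complex matrices, with the operator norm of Hilbert space `ℂⁿ`. -/
abbrev Mat (n : ℕ) : Type := Matrix (Fin n) (Fin n) ℂ

/-- The one-variable pencil `I_d ⊗ I_n + A ⊗ X + A^* ⊗ X^*`. -/
def pencil {d : ℕ} (A : Mat d) {n : ℕ} (X : Mat n) :
    Matrix (Fin d × Fin n) (Fin d × Fin n) ℂ :=
  (1 : Mat d) ⊗ₖ (1 : Mat n) + A ⊗ₖ X + Aᴴ ⊗ₖ Xᴴ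

/-- The one-variable LMI domain of `A`: at level `n`, the `n × n` matrices at which the pencil
is positive definite. (Level `0` is a single point and carries no information.) -/
def lmiDomain {d : ℕ} (A : Mat d) (n : ℕ) : Set (Mat n) :=
  {X | (pencil A X).PosDef}

/-- The LMI domain of the coefficient matrix with rows `(1, 1)` and `(0, 0)`. -/
def domL (n : ℕ) : Set (Mat n) :=
  lmiDomain (!![1, 1; 0, 0] : Mat 2) n

/-- `f = (f n)` is a free map from `U` to `V`: it maps `U n` into `V n` and respects
intertwining maps. Only the values of `f n` on `U n` matter. -/
def IsFreeMap (U V : (n : ℕ) → Set (Mat n)) (f : (n : ℕ) → Mat n → Mat n) : Prop :=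
  (∀ n, Set.MapsTo (f n) (U n) (V n)) ∧
  ∀ (n m : ℕ) (X : Mat n) (Y : Mat m) (Γ : Matrix (Fin n) (Fin m) ℂ),
    X ∈ U n → Y ∈ U m → X * Γ = Γ * Y → f n X * Γ = Γ * f m Y

/-- Each `f n` is continuous on `U n`. -/
def IsContinuous (U : (n : ℕ) → Set (Mat n)) (f : (n : ℕ) → Mat n → Mat n) : Prop :=
  ∀ n, ContinuousOn (f n) (U n)

/-- Each `f n` is (complex) analytic on `U n`. -/
def IsAnalytic (U : (n : ℕ) → Set (Mat n)) (f : (n : ℕ) → Mat n → Mat n) : Prop :=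
  ∀ n, AnalyticOnNhd ℂ (f n) (U n)

/-- Each `f n : U n → V n` is proper: preimages of compact subsets of `V n` are compact. -/
def IsProper (U V : (n : ℕ) → Set (Mat n)) (f : (n : ℕ) → Mat n → Mat n) : Prop :=
  ∀ n, ∀ K : Set (Mat n), K ⊆ V n → IsCompact K → IsCompact (U n ∩ f n ⁻¹' K)

/-- `f` is a proper continuous free map from `U` to `V`. -/
structure IsProperContinuousFreeMap (U V : (n : ℕ) → Set (Mat n))
    (f : (n : ℕ) → Mat n → Mat n) : Prop where
  free : IsFreeMap U V f
  cont : IsContinuous U f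
  proper : IsProper U V f

/-- The denominator `1 + x - e^{iθ} x`. -/
noncomputable def denTheta (θ : ℝ) (n : ℕ) (X : Mat n) : Mat n :=
  1 + X - Complex.exp (θ * Complex.I) • X

/-- The map `f_θ(x) = e^{iθ} x (1 + x - e^{iθ} x)⁻¹`. -/
noncomputable def fTheta (θ : ℝ) (n : ℕ) (X : Mat n) : Mat n :=
  (Complex.exp (θ * Complex.I) • X) * (denTheta θ n X)⁻¹

end FreeMap

/-! The substitution `y = x / (1 + x)` turns `|x - 1| < √2` into `|y| < 1/√2` and turns `f_θ` into
`y ↦ e^{iθ} y`. This explains why `f_θ` preserves the domain and has inverse `f_{-θ}`; hence it is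
proper.

Conversely, a free map acts on eigenvectors through its scalar part `F`, so continuity and density
of matrices with simple spectrum reduce the claim to `F` (`eqOn_domL_of_eqOn_one`). Continuity on
upper triangular `2 × 2` matrices makes `F` holomorphic, since the corner entry is a divided
difference. Level 1 properness alone would still allow Blaschke products. The rigidity comes from
level 2: `f` scales the corner of a nilpotent matrix by `F'(0)`, and properness forces `1 ≤ |F'(0)|`
(`one_le_norm_deriv_scalarPart`). In the coordinate `y` the Schwarz lemma gives the reverse bound,
and its equality case is a rotation. -/

namespace FreeMap

/-! ### Matrices with simple spectrum -/

/-- Matrices with separable characteristic polynomial are dense. -/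
theorem dense_charpoly_separable (n : ℕ) : Dense {X : Mat n | X.charpoly.Separable} := by
  intro X
  let D : Mat n := Matrix.diagonal fun i => (i : ℂ)
  have hD : D.charpoly.Separable := by
    rw [Matrix.charpoly_diagonal, Polynomial.separable_prod_X_sub_C_iff]
    intro i j h
    exact Fin.ext (Nat.cast_injective (R := ℂ) h)
  let M : Matrix (Fin n) (Fin n) (Polynomial ℂ) :=
    X.map Polynomial.C + (Polynomial.X : Polynomial ℂ) • (D - X).map Polynomial.C
  let p := M.charpoly
  -- A discriminant along the line from `X` to `D`, nonzero at `t = 1`. Fixing the formal degrees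
  -- `n` and `n - 1` makes it commute with evaluation at `t`.
  let q : Polynomial ℂ := Polynomial.resultant p p.derivative n (n - 1)
  have hM (t : ℂ) : (Polynomial.evalRingHom t).mapMatrix M = X + t • (D - X) := by
    ext i j
    simp [M]
  have hp (t : ℂ) : p.map (Polynomial.evalRingHom t) = (X + t • (D - X)).charpoly := by
    rw [← hM, RingHom.mapMatrix_apply, Matrix.charpoly_map]
  have hq (t : ℂ) : q.eval t ≠ 0 ↔ (X + t • (D - X)).charpoly.Separable := by
    rw [Polynomial.Separable, ← Polynomial.isUnit_resultant_iff_isCoprime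
      (Matrix.charpoly_monic _), isUnit_iff_ne_zero, Polynomial.natDegree_derivative,
      Matrix.charpoly_natDegree_eq_dim, Fintype.card_fin, ← hp t, Polynomial.derivative_map,
      Polynomial.resultant_map_map, Polynomial.coe_evalRingHom]
  have hq0 : q ≠ 0 := by
    intro h
    have := (hq 1).2 (by simpa using hD)
    simp [h] at this
  have hfin : ∀ᶠ t in nhdsWithin (0 : ℂ) {0}ᶜ, q.eval t ≠ 0 := by
    have hs : (q.rootSet ℂ \ {0} : Set ℂ).Finite := (q.rootSet_finite ℂ).subset Set.sdiff_subset
    have : (q.rootSet ℂ \ {0} : Set ℂ)ᶜ ∈ nhds (0 : ℂ) :=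
      hs.isClosed.isOpen_compl.mem_nhds (by simp)
    filter_upwards [nhdsWithin_le_nhds this, self_mem_nhdsWithin] with t ht ht0 hroot
    exact ht ⟨by simpa [Polynomial.mem_rootSet, hq0] using hroot, ht0⟩
  have hlim : Filter.Tendsto (fun t : ℂ => X + t • (D - X)) (nhdsWithin 0 {0}ᶜ) (nhds X) := by
    have : Continuous fun t : ℂ => X + t • (D - X) := by fun_prop
    simpa using (this.tendsto 0).mono_left nhdsWithin_le_nhds
  exact mem_closure_of_tendsto hlim (hfin.mono fun t ht => (hq t).1 ht)

/-- A matrix annihilating every eigenvector of a matrix with separable characteristic polynomial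
vanishes. -/
theorem eq_zero_of_mulVec_eigenvector {n : ℕ} {X Z : Mat n} (hX : X.charpoly.Separable)
    (h : ∀ (μ : ℂ) (v : Fin n → ℂ), X *ᵥ v = μ • v → Z *ᵥ v = 0) : Z = 0 := by
  let T : Module.End ℂ (Fin n → ℂ) := Matrix.toLin' X
  have hss : T.IsSemisimple := by
    refine Module.End.isSemisimple_of_squarefree_aeval_eq_zero hX.squarefree ?_
    have := Matrix.aeval_self_charpoly X
    have h2 := congrArg (Matrix.toLinAlgEquiv' (R := ℂ) (n := Fin n)) this
    rw [← Polynomial.aeval_algHom_apply] at h2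
    exact h2.trans (map_zero _)
  have htop : ⨆ μ, T.eigenspace μ = ⊤ := by
    rw [← Module.End.iSup_maxGenEigenspace_eq_top T]
    simp_rw [hss.isFinitelySemisimple.maxGenEigenspace_eq_eigenspace]
  have hle : ⨆ μ, T.eigenspace μ ≤ LinearMap.ker (Matrix.toLin' Z) := by
    refine iSup_le fun μ v hv => ?_
    have hv : X *ᵥ v = μ • v := by simpa [T] using Module.End.mem_eigenspace_iff.1 hv
    simpa using h μ v hv
  rw [htop, top_le_iff, LinearMap.ker_eq_top] at hle
  exact (Matrix.toLin' (R := ℂ)).map_eq_zero_iff.1 hle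

/-! ### The LMI domain as a ball -/

theorem posDef_fromBlocks_diagonal {m n : Type*} [Fintype m] [Fintype n]
    {A : Matrix m m ℂ} {B : Matrix n n ℂ} (hB : B.PosDef) :
    (Matrix.fromBlocks A 0 0 B).PosDef ↔ A.PosDef := by
  refine ⟨fun h => ?_, fun hA => ?_⟩
  · exact h.submatrix (e := Sum.inl) Sum.inl_injective
  · rw [Matrix.posDef_iff_dotProduct_mulVec] at hA hB ⊢
    refine ⟨Matrix.IsHermitian.fromBlocks hA.1 (by simp) hB.1, fun x hx => ?_⟩
    obtain ⟨u, v, rfl⟩ : ∃ u v, x = Sum.elim u v := ⟨_, _, (Sum.elim_comp_inl_inr x).symm⟩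
    rw [Matrix.fromBlocks_mulVec]
    have e : star (Sum.elim u v) = Sum.elim (star u) (star v) := by ext (i | i) <;> rfl
    simp only [e, Sum.elim_comp_inl, Sum.elim_comp_inr, Matrix.zero_mulVec, add_zero, zero_add,
      sumElim_dotProduct_sumElim]
    by_cases hu : u = 0
    · have hv : v ≠ 0 := by
        rintro rfl
        exact hx (by ext (i | i) <;> simp [hu])
      simpa [hu] using hB.2 hv
    · refine add_pos_of_pos_of_nonneg (hA.2 hu) ?_
      by_cases hv : v = 0
      · simp [hv]
      · exact (hB.2 hv).le

/-- Schur complement of the identity block of the pencil. -/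
theorem mem_domL_iff_posDef_right {n : ℕ} {X : Mat n} :
    X ∈ domL n ↔ (1 + X + Xᴴ - X * Xᴴ).PosDef := by
  let e : Fin n ⊕ Fin n ≃ Fin 2 × Fin n :=
    { toFun := Sum.elim (fun i => (0, i)) (fun i => (1, i))
      invFun := fun p => if p.1 = 0 then Sum.inl p.2 else Sum.inr p.2
      left_inv := by rintro (i | i) <;> simp
      right_inv := by
        rintro ⟨a, i⟩
        fin_cases a <;> simp }
  have he : (pencil (!![1, 1; 0, 0] : Mat 2) X).submatrix e e =
      Matrix.fromBlocks (1 + X + Xᴴ) X Xᴴ 1 := by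
    ext (i | i) (j | j) <;> simp [e, pencil, Matrix.one_apply]
  have hU : IsUnit (Matrix.fromBlocks 1 (-X) 0 1 : Matrix (Fin n ⊕ Fin n) (Fin n ⊕ Fin n) ℂ) := by
    simp
  have hc : (Matrix.fromBlocks 1 (-X) 0 1 : Matrix (Fin n ⊕ Fin n) (Fin n ⊕ Fin n) ℂ) *
      Matrix.fromBlocks (1 + X + Xᴴ) X Xᴴ 1 * star (Matrix.fromBlocks 1 (-X) 0 1) =
      Matrix.fromBlocks (1 + X + Xᴴ - X * Xᴴ) 0 0 1 := by
    rw [Matrix.star_eq_conjTranspose, Matrix.fromBlocks_conjTranspose, Matrix.fromBlocks_multiply,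
      Matrix.fromBlocks_multiply]
    simp [sub_eq_add_neg]
  have h1 : (pencil (!![1, 1; 0, 0] : Mat 2) X).PosDef ↔
      ((pencil (!![1, 1; 0, 0] : Mat 2) X).submatrix e e).PosDef := by
    refine ⟨fun h => h.submatrix e.injective, fun h => ?_⟩
    simpa using h.submatrix e.symm.injective
  change (pencil (!![1, 1; 0, 0] : Mat 2) X).PosDef ↔ _
  rw [h1, he, ← Matrix.IsUnit.posDef_star_right_conjugate_iff hU, hc,
    posDef_fromBlocks_diagonal Matrix.PosDef.one]

open scoped MatrixOrder in
theorem norm_lt_iff_posDef {n : ℕ} (B : Mat n) {r : ℝ} (hr : 0 < r) :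
    ‖B‖ < r ↔ (((r ^ 2 : ℝ) : ℂ) • (1 : Mat n) - Bᴴ * B).PosDef := by
  have key (v : Fin n → ℂ) : star v ⬝ᵥ (((r ^ 2 : ℝ) : ℂ) • (1 : Mat n) - Bᴴ * B) *ᵥ v =
      ((r ^ 2 * ‖WithLp.toLp 2 v‖ ^ 2 - ‖WithLp.toLp 2 (B *ᵥ v)‖ ^ 2 : ℝ) : ℂ) := by
    have hn (w : Fin n → ℂ) : star w ⬝ᵥ w = ((‖WithLp.toLp 2 w‖ ^ 2 : ℝ) : ℂ) := by
      rw [EuclideanSpace.norm_sq_eq]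
      simp [dotProduct, Complex.conj_mul']
    rw [Matrix.sub_mulVec, dotProduct_sub, ← Matrix.mulVec_mulVec, Matrix.dotProduct_mulVec _ Bᴴ,
      ← Matrix.star_mulVec, hn, Matrix.smul_mulVec, dotProduct_smul, Matrix.one_mulVec, hn]
    push_cast
    simp
  have hherm : (((r ^ 2 : ℝ) : ℂ) • (1 : Mat n) - Bᴴ * B).IsHermitian := by
    refine Matrix.IsHermitian.sub ?_ (Matrix.isHermitian_conjTranspose_mul_self B)
    rw [Matrix.IsHermitian, Matrix.conjTranspose_smul]
    simp
  constructor
  · intro h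
    refine Matrix.PosDef.of_dotProduct_mulVec_pos hherm fun v hv => ?_
    rw [key, Complex.zero_lt_real, sub_pos]
    have hv' : 0 < ‖WithLp.toLp 2 v‖ := by
      rw [norm_pos_iff]
      simpa using hv
    have := Matrix.l2_opNorm_mulVec B (WithLp.toLp 2 v)
    have h2 : ‖WithLp.toLp 2 (B *ᵥ v)‖ ≤ ‖B‖ * ‖WithLp.toLp 2 v‖ := this
    rw [← mul_pow]
    exact pow_lt_pow_left₀ (h2.trans_lt (mul_lt_mul_of_pos_right h hv')) (norm_nonneg _) two_ne_zero
  · intro h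
    by_cases hn : Nontrivial (Mat n)
    swap
    · rw [not_nontrivial_iff_subsingleton] at hn
      rw [Subsingleton.elim B 0, norm_zero]
      exact hr
    by_contra! hB
    -- The norm of the positive matrix `Bᴴ * B` is one of its eigenvalues.
    obtain ⟨v, hv0, hv⟩ : ∃ v : Fin n → ℂ, v ≠ 0 ∧ (Bᴴ * B) *ᵥ v = ((‖B‖ ^ 2 : ℝ) : ℂ) • v := by
      have h0 : 0 ≤ Bᴴ * B := (Matrix.posSemidef_conjTranspose_mul_self B).nonneg
      have hs := CStarAlgebra.norm_mem_spectrum_of_nonneg (a := Bᴴ * B) h0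
      rw [spectrum.mem_iff, Matrix.isUnit_iff_isUnit_det, isUnit_iff_ne_zero, not_not,
        ← Matrix.exists_mulVec_eq_zero_iff] at hs
      obtain ⟨v, hv0, hv⟩ := hs
      refine ⟨v, hv0, ?_⟩
      rw [Matrix.sub_mulVec, sub_eq_zero, Matrix.l2_opNorm_conjTranspose_mul_self, ← sq] at hv
      rw [← hv, Algebra.algebraMap_eq_smul_one, Matrix.smul_mulVec, Matrix.one_mulVec,
        Complex.coe_smul]
    have h2 := h.dotProduct_mulVec_pos hv0
    rw [Matrix.sub_mulVec, hv, Matrix.smul_mulVec, Matrix.one_mulVec, ← sub_smul,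
      dotProduct_smul, ← Complex.ofReal_sub] at h2
    have h3 : (0 : ℂ) ≤ star v ⬝ᵥ v := dotProduct_star_self_nonneg v
    have h4 : ((r ^ 2 - ‖B‖ ^ 2 : ℝ) : ℂ) ≤ 0 := by
      exact_mod_cast sub_nonpos.2 (pow_le_pow_left₀ hr.le hB 2)
    exact (mul_nonpos_of_nonpos_of_nonneg h4 h3).not_gt h2

theorem mem_domL_iff_norm {n : ℕ} {X : Mat n} : X ∈ domL n ↔ ‖X - 1‖ < Real.sqrt 2 := by
  rw [mem_domL_iff_posDef_right, ← Matrix.l2_opNorm_conjTranspose,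
    norm_lt_iff_posDef _ (Real.sqrt_pos.2 two_pos), Matrix.conjTranspose_conjTranspose,
    Real.sq_sqrt zero_le_two]
  congr! 1
  rw [Matrix.conjTranspose_sub, Matrix.conjTranspose_one, Complex.ofReal_ofNat, two_smul]
  noncomm_ring

theorem mem_domL_iff_posDef {n : ℕ} {X : Mat n} :
    X ∈ domL n ↔ (1 + X + Xᴴ - Xᴴ * X).PosDef := by
  rw [mem_domL_iff_norm, norm_lt_iff_posDef _ (Real.sqrt_pos.2 two_pos),
    Real.sq_sqrt zero_le_two]
  congr! 1
  rw [Matrix.conjTranspose_sub, Matrix.conjTranspose_one, Complex.ofReal_ofNat, two_smul]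
  noncomm_ring

theorem isOpen_domL (n : ℕ) : IsOpen (domL n) := by
  have : domL n = {X : Mat n | ‖X - 1‖ < Real.sqrt 2} := Set.ext fun _ => mem_domL_iff_norm
  rw [this]
  exact isOpen_lt (by fun_prop) continuous_const

theorem zero_mem_domL (n : ℕ) : (0 : Mat n) ∈ domL n := by
  simpa [mem_domL_iff_posDef] using Matrix.PosDef.one

/-! ### The maps `f_θ` -/

theorem star_exp_mul_exp (θ : ℝ) :
    star (Complex.exp (θ * Complex.I)) * Complex.exp (θ * Complex.I) = 1 := by
  rw [Complex.star_def, Complex.conj_mul', Complex.norm_exp_ofReal_mul_I]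
  simp

/-- With `D` the denominator and `N = e^{iθ} X`, one has `D + N = 1 + X` and `Nᴴ N = Xᴴ X`; both
sides are `(1 + X)ᴴ (1 + X) - 2 Xᴴ X`. When `D` is invertible, the form defining the domain at `N
D⁻¹` is thus congruent to that at `X`. -/
theorem denTheta_conjTranspose_identity (θ : ℝ) {n : ℕ} (X : Mat n) :
    (denTheta θ n X)ᴴ * denTheta θ n X
        + (denTheta θ n X)ᴴ * (Complex.exp (θ * Complex.I) • X)
        + (Complex.exp (θ * Complex.I) • X)ᴴ * denTheta θ n X
        - (Complex.exp (θ * Complex.I) • X)ᴴ * (Complex.exp (θ * Complex.I) • X)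
      = 1 + X + Xᴴ - Xᴴ * X := by
  have hc := star_exp_mul_exp θ
  unfold denTheta
  generalize Complex.exp (θ * Complex.I) = c at hc ⊢
  simp only [Matrix.conjTranspose_sub, Matrix.conjTranspose_add, Matrix.conjTranspose_one,
    Matrix.conjTranspose_smul, mul_add, add_mul, mul_sub, sub_mul, one_mul, mul_one, smul_mul_assoc,
    mul_smul_comm, smul_smul, mul_comm c, hc, one_smul]
  abel

theorem isUnit_denTheta (θ : ℝ) {n : ℕ} {X : Mat n} (hX : X ∈ domL n) :
    IsUnit (denTheta θ n X) := by
  rw [mem_domL_iff_posDef, ← denTheta_conjTranspose_identity θ] at hX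
  rw [Matrix.isUnit_iff_isUnit_det, isUnit_iff_ne_zero, Ne, ← Matrix.exists_mulVec_eq_zero_iff]
  -- On a kernel vector of the denominator only `-‖Z v‖²` survives, which cannot be positive.
  rintro ⟨v, hv0, hv⟩
  have h := hX.dotProduct_mulVec_pos hv0
  generalize Complex.exp (θ * Complex.I) • X = Z at h
  have hv' : star v ᵥ* (denTheta θ n X)ᴴ = 0 := by
    rw [← Matrix.star_mulVec, hv, star_zero]
  simp only [Matrix.sub_mulVec, Matrix.add_mulVec, ← Matrix.mulVec_mulVec, hv, Matrix.mulVec_zero,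
    dotProduct_sub, dotProduct_add, Matrix.dotProduct_mulVec (star v), hv', zero_dotProduct,
    dotProduct_zero, zero_add, zero_sub, ← Matrix.star_mulVec] at h
  exact (dotProduct_star_self_nonneg _).not_gt (neg_pos.1 h)

theorem fTheta_mul_denTheta (θ : ℝ) {n : ℕ} {X : Mat n} (hX : X ∈ domL n) :
    fTheta θ n X * denTheta θ n X = Complex.exp (θ * Complex.I) • X := by
  have := isUnit_denTheta θ hX
  rw [Matrix.isUnit_iff_isUnit_det] at this
  rw [fTheta, mul_assoc, Matrix.nonsing_inv_mul _ this, mul_one]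

theorem fTheta_mem_domL (θ : ℝ) {n : ℕ} {X : Mat n} (hX : X ∈ domL n) :
    fTheta θ n X ∈ domL n := by
  have hu := isUnit_denTheta θ hX
  have hm := fTheta_mul_denTheta θ hX
  rw [mem_domL_iff_posDef, ← Matrix.IsUnit.posDef_star_left_conjugate_iff hu]
  rw [mem_domL_iff_posDef, ← denTheta_conjTranspose_identity θ, ← hm] at hX
  convert! hX using 1
  rw [Matrix.star_eq_conjTranspose, Matrix.conjTranspose_mul]
  noncomm_ring

theorem denTheta_mul_of_intertwines (θ : ℝ) {n m : ℕ} {X : Mat n} {Y : Mat m}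
    {Γ : Matrix (Fin n) (Fin m) ℂ} (h : X * Γ = Γ * Y) :
    denTheta θ n X * Γ = Γ * denTheta θ m Y := by
  simp [denTheta, Matrix.sub_mul, Matrix.add_mul, Matrix.mul_sub, Matrix.mul_add, h]

theorem fTheta_mul_of_intertwines (θ : ℝ) {n m : ℕ} {X : Mat n} {Y : Mat m}
    {Γ : Matrix (Fin n) (Fin m) ℂ} (hX : X ∈ domL n) (hY : Y ∈ domL m) (h : X * Γ = Γ * Y) :
    fTheta θ n X * Γ = Γ * fTheta θ m Y := by
  have hX' := (Matrix.isUnit_iff_isUnit_det _).1 (isUnit_denTheta θ hX)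
  have hY' := (Matrix.isUnit_iff_isUnit_det _).1 (isUnit_denTheta θ hY)
  have hd : (denTheta θ n X)⁻¹ * Γ = Γ * (denTheta θ m Y)⁻¹ := by
    calc (denTheta θ n X)⁻¹ * Γ =
        (denTheta θ n X)⁻¹ * (Γ * denTheta θ m Y) * (denTheta θ m Y)⁻¹ := by
          rw [Matrix.mul_assoc, Matrix.mul_assoc, Matrix.mul_nonsing_inv _ hY', Matrix.mul_one]
      _ = Γ * (denTheta θ m Y)⁻¹ := by
          rw [← denTheta_mul_of_intertwines θ h, ← Matrix.mul_assoc,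
            Matrix.nonsing_inv_mul _ hX', Matrix.one_mul]
  rw [fTheta, fTheta, Matrix.mul_assoc, hd, ← Matrix.mul_assoc, ← Matrix.mul_assoc,
    Matrix.smul_mul, h, Matrix.mul_smul]

theorem isFreeMap_fTheta (θ : ℝ) : IsFreeMap domL domL (fTheta θ) :=
  ⟨fun _ _ hX => fTheta_mem_domL θ hX, fun _ _ _ _ _ hX hY h =>
    fTheta_mul_of_intertwines θ hX hY h⟩

theorem fTheta_neg_fTheta (θ : ℝ) {n : ℕ} {X : Mat n} (hX : X ∈ domL n) :
    fTheta (-θ) n (fTheta θ n X) = X := by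
  have hu := isUnit_denTheta θ hX
  have hm := fTheta_mul_denTheta θ hX
  have hW := fTheta_mem_domL θ hX
  have hu' := isUnit_denTheta (-θ) hW
  have hm' := fTheta_mul_denTheta (-θ) hW
  have hc : Complex.exp ((-θ : ℝ) * Complex.I) * Complex.exp (θ * Complex.I) = 1 := by
    rw [← Complex.exp_add]
    simp
  have hden : denTheta (-θ) n (fTheta θ n X) * denTheta θ n X = 1 + X - X := by
    rw [denTheta, sub_mul, add_mul, smul_mul_assoc, hm, smul_smul, hc, one_smul, one_mul, denTheta]
    abel
  rw [add_sub_cancel_right] at hden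
  calc fTheta (-θ) n (fTheta θ n X) =
      fTheta (-θ) n (fTheta θ n X) * (denTheta (-θ) n (fTheta θ n X) * denTheta θ n X) := by
        rw [hden, mul_one]
    _ = X := by
        rw [← mul_assoc, hm', smul_mul_assoc, hm, smul_smul, hc, one_smul]

theorem isAnalytic_fTheta (θ : ℝ) : IsAnalytic domL (fTheta θ) := by
  intro n X hX
  have hu := isUnit_denTheta θ hX
  have hd : AnalyticAt ℂ (denTheta θ n) X := by
    unfold denTheta
    fun_prop
  have hinv : AnalyticAt ℂ (fun Y : Mat n => Ring.inverse (denTheta θ n Y)) X := by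
    obtain ⟨u, hu⟩ := hu
    refine AnalyticAt.comp (g := Ring.inverse) ?_ hd
    rw [← hu]
    exact analyticAt_inverse u
  have : fTheta θ n = fun Y => (Complex.exp (θ * Complex.I) • Y) * Ring.inverse (denTheta θ n Y) := by
    funext Y
    rw [fTheta, Matrix.nonsing_inv_eq_ringInverse]
  rw [this]
  fun_prop

theorem isContinuous_fTheta (θ : ℝ) : IsContinuous domL (fTheta θ) := fun n =>
  (isAnalytic_fTheta θ n).continuousOn

theorem isProper_fTheta (θ : ℝ) : IsProper domL domL (fTheta θ) := by
  intro n K hK hKc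
  have : domL n ∩ fTheta θ n ⁻¹' K = fTheta (-θ) n '' K := by
    ext X
    constructor
    · rintro ⟨hX, hXK⟩
      exact ⟨_, hXK, fTheta_neg_fTheta θ hX⟩
    · rintro ⟨Y, hY, rfl⟩
      refine ⟨fTheta_mem_domL _ (hK hY), ?_⟩
      have := fTheta_neg_fTheta (-θ) (hK hY)
      rw [neg_neg] at this
      rwa [Set.mem_preimage, this]
  rw [this]
  exact hKc.image_of_continuousOn ((isContinuous_fTheta (-θ) n).mono hK)

theorem isProperContinuousFreeMap_fTheta (θ : ℝ) :
    IsProperContinuousFreeMap domL domL (fTheta θ) :=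
  ⟨isFreeMap_fTheta θ, isContinuous_fTheta θ, isProper_fTheta θ⟩

theorem fTheta_zero (θ : ℝ) (n : ℕ) : fTheta θ n 0 = 0 := by
  simp [fTheta]

theorem hasFDerivAt_fTheta_zero (θ : ℝ) (n : ℕ) :
    HasFDerivAt (𝕜 := ℂ) (fTheta θ n)
      (Complex.exp (θ * Complex.I) • ContinuousLinearMap.id ℂ (Mat n)) 0 := by
  have hd := (isAnalytic_fTheta θ n 0 (zero_mem_domL n)).differentiableAt.hasFDerivAt
  -- Differentiating this product at `0`, where the factors are `0` and `1`, avoids differentiating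
  -- the inverse.
  have heq : (fun Y : Mat n => fTheta θ n Y * denTheta θ n Y) =ᶠ[nhds 0]
      fun Y => Complex.exp (θ * Complex.I) • Y :=
    Filter.eventually_of_mem ((isOpen_domL n).mem_nhds (zero_mem_domL n)) fun Y hY =>
      fTheta_mul_denTheta θ hY
  have hden : DifferentiableAt ℂ (denTheta θ n) 0 := by
    unfold denTheta
    fun_prop
  have h1 := (hd.mul' hden.hasFDerivAt).congr_of_eventuallyEq heq.symm
  have h2 : HasFDerivAt (fun Y : Mat n => Complex.exp (θ * Complex.I) • Y)
      (Complex.exp (θ * Complex.I) • ContinuousLinearMap.id ℂ (Mat n)) 0 :=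
    (Complex.exp (θ * Complex.I) • ContinuousLinearMap.id ℂ (Mat n)).hasFDerivAt
  have h3 := h1.unique h2
  have hd0 : denTheta θ n 0 = 1 := by simp [denTheta]
  rw [← h3]
  convert! hd using 1
  ext1 H
  simp [fTheta_zero, hd0]

/-! ### Free maps and their scalar parts -/

theorem norm_sub_one_le_of_eigenvector {n : ℕ} {X : Mat n} {μ : ℂ} {v : Fin n → ℂ} (hv0 : v ≠ 0)
    (hv : X *ᵥ v = μ • v) : ‖μ - 1‖ ≤ ‖X - 1‖ := by
  have h : ‖WithLp.toLp 2 ((X - 1) *ᵥ v)‖ ≤ ‖X - 1‖ * ‖WithLp.toLp 2 v‖ :=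
    Matrix.l2_opNorm_mulVec (X - 1) (WithLp.toLp 2 v)
  have hv' : 0 < ‖WithLp.toLp 2 v‖ := by
    rw [norm_pos_iff]
    simpa using hv0
  have e : (X - 1) *ᵥ v = (μ - 1) • v := by
    rw [Matrix.sub_mulVec, hv, Matrix.one_mulVec, sub_smul, one_smul]
  rw [e, WithLp.toLp_smul, norm_smul] at h
  exact le_of_mul_le_mul_right h hv'

theorem smul_one_mem_domL {z : ℂ} (hz : ‖z - 1‖ < Real.sqrt 2) (n : ℕ) :
    z • (1 : Mat n) ∈ domL n := by
  have e : z • (1 : Mat n) - 1 = (z - 1) • 1 := by rw [sub_smul, one_smul]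
  rw [mem_domL_iff_norm, e, norm_smul]
  rcases subsingleton_or_nontrivial (Mat n) with h | h
  · rw [Subsingleton.elim (1 : Mat n) 0, norm_zero, mul_zero]
    positivity
  · rwa [CStarRing.norm_one, mul_one]

theorem smul_one_mem_domL_one {z : ℂ} : z • (1 : Mat 1) ∈ domL 1 ↔ ‖z - 1‖ < Real.sqrt 2 := by
  refine ⟨fun h => ?_, fun h => smul_one_mem_domL h 1⟩
  refine lt_of_le_of_lt (norm_sub_one_le_of_eigenvector (v := fun _ => 1) ?_ ?_)
    (mem_domL_iff_norm.1 h)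
  · exact fun h => one_ne_zero (congrFun h 0)
  · rw [Matrix.smul_mulVec, Matrix.one_mulVec]

theorem eq_smul_one (X : Mat 1) : X = X 0 0 • (1 : Mat 1) := by
  ext i j
  fin_cases i
  fin_cases j
  simp

/-- The restriction of a sequence of matrix functions to scalars. -/
def scalarPart (f : (n : ℕ) → Mat n → Mat n) (z : ℂ) : ℂ := f 1 (z • 1) 0 0

variable {f g : (n : ℕ) → Mat n → Mat n}

theorem scalarPart_smul_one (f : (n : ℕ) → Mat n → Mat n) (z : ℂ) :
    f 1 (z • 1) = scalarPart f z • (1 : Mat 1) := eq_smul_one _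

/-- An eigenvector, read as a column, intertwines `X` with the `1 × 1` matrix `μ`. -/
theorem IsFreeMap.mulVec_eigenvector (hf : IsFreeMap domL domL f) {n : ℕ} {X : Mat n}
    (hX : X ∈ domL n) {μ : ℂ} {v : Fin n → ℂ} (hv : X *ᵥ v = μ • v) :
    f n X *ᵥ v = scalarPart f μ • v := by
  by_cases hv0 : v = 0
  · simp [hv0]
  have hμ : μ • (1 : Mat 1) ∈ domL 1 := smul_one_mem_domL
    ((norm_sub_one_le_of_eigenvector hv0 hv).trans_lt (mem_domL_iff_norm.1 hX)) 1
  have h := hf.2 n 1 X (μ • 1) (Matrix.replicateCol (Fin 1) v) hX hμ (by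
    rw [← Matrix.replicateCol_mulVec, hv, Matrix.mul_smul, Matrix.mul_one]
    rfl)
  rw [scalarPart_smul_one f, ← Matrix.replicateCol_mulVec, Matrix.mul_smul, Matrix.mul_one] at h
  funext i
  exact congrFun (congrFun h i) 0

/-- Continuous free maps are determined by their values on scalars. -/
theorem eqOn_domL_of_eqOn_one (hf : IsFreeMap domL domL f) (hfc : IsContinuous domL f)
    (hg : IsFreeMap domL domL g) (hgc : IsContinuous domL g) (h : Set.EqOn (f 1) (g 1) (domL 1))
    (n : ℕ) : Set.EqOn (f n) (g n) (domL n) := by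
  refine Set.EqOn.of_subset_closure (s := domL n ∩ {X : Mat n | X.charpoly.Separable}) ?_
    (hfc n) (hgc n) Set.inter_subset_left
    ((dense_charpoly_separable n).open_subset_closure_inter (isOpen_domL n))
  rintro X ⟨hX, hs⟩
  refine sub_eq_zero.1 (eq_zero_of_mulVec_eigenvector hs fun μ v hv => ?_)
  by_cases hv0 : v = 0
  · rw [hv0, Matrix.mulVec_zero]
  have hμ : μ • (1 : Mat 1) ∈ domL 1 := smul_one_mem_domL
    ((norm_sub_one_le_of_eigenvector hv0 hv).trans_lt (mem_domL_iff_norm.1 hX)) 1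
  rw [Matrix.sub_mulVec, hf.mulVec_eigenvector hX hv, hg.mulVec_eigenvector hX hv, scalarPart,
    scalarPart, h hμ, sub_self]

/-! ### Holomorphy of the scalar part -/

theorem continuous_upperTriangular {α : Type*} [TopologicalSpace α] {a b c : α → ℂ}
    (ha : Continuous a) (hb : Continuous b) (hc : Continuous c) :
    Continuous fun x => (!![a x, b x; 0, c x] : Mat 2) := by
  refine continuous_matrix fun i j => ?_
  fin_cases i <;> fin_cases j <;> simp <;> fun_prop

/-- For `w ≠ z` the eigenvectors `(1, 0)` and `(δ, w - z)` force the corner entry of the image to be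
`δ` times the slope of `F`; let `w → z`. -/
theorem hasDerivAt_scalarPart (hf : IsFreeMap domL domL f) (hfc : IsContinuous domL f)
    {z δ : ℂ} (hδ : δ ≠ 0) (hz : (!![z, δ; 0, z] : Mat 2) ∈ domL 2) :
    HasDerivAt (scalarPart f) (f 2 !![z, δ; 0, z] 0 1 / δ) z := by
  rw [hasDerivAt_iff_tendsto_slope]
  have hT : Continuous fun w : ℂ => (!![z, δ; 0, w] : Mat 2) :=
    continuous_upperTriangular continuous_const continuous_const continuous_id
  have hmem : ∀ᶠ w in nhds z, (!![z, δ; 0, w] : Mat 2) ∈ domL 2 :=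
    hT.continuousAt.eventually_mem ((isOpen_domL 2).mem_nhds hz)
  have hcont : ContinuousAt (fun w => f 2 !![z, δ; 0, w] 0 1 / δ) z := by
    have h1 : ContinuousAt (fun w => f 2 !![z, δ; 0, w]) z :=
      ContinuousAt.comp (g := f 2) ((hfc 2).continuousAt ((isOpen_domL 2).mem_nhds hz))
        hT.continuousAt
    have h2 : Continuous fun X : Mat 2 => X 0 1 := continuous_id.matrix_elem 0 1
    exact (h2.continuousAt.comp h1).div_const δ
  refine (hcont.tendsto.mono_left nhdsWithin_le_nhds).congr' ?_
  filter_upwards [nhdsWithin_le_nhds hmem, self_mem_nhdsWithin] with w hw hne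
  have e1 := congrFun (hf.mulVec_eigenvector hw (μ := z) (v := ![1, 0]) (by
    funext i; fin_cases i <;> simp)) 0
  have e2 := congrFun (hf.mulVec_eigenvector hw (μ := w) (v := ![δ, w - z]) (by
    funext i; fin_cases i <;> simp [Matrix.mulVec, dotProduct]; ring)) 0
  have hwz : w - z ≠ 0 := sub_ne_zero.2 hne
  simp [Matrix.mulVec, dotProduct] at e1 e2
  rw [e1] at e2
  rw [slope_def_field]
  field_simp
  linear_combination e2

theorem differentiableAt_scalarPart (hf : IsFreeMap domL domL f) (hfc : IsContinuous domL f)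
    {z : ℂ} (hz : ‖z - 1‖ < Real.sqrt 2) : DifferentiableAt ℂ (scalarPart f) z := by
  have hT : Continuous fun δ : ℂ => (!![z, δ; 0, z] : Mat 2) :=
    continuous_upperTriangular continuous_const continuous_id continuous_const
  have h0 : (!![z, 0; 0, z] : Mat 2) = z • 1 := by
    ext i j
    fin_cases i <;> fin_cases j <;> simp
  have hmem : ∀ᶠ δ in nhds (0 : ℂ), (!![z, δ; 0, z] : Mat 2) ∈ domL 2 := by
    refine hT.continuousAt.eventually_mem ((isOpen_domL 2).mem_nhds ?_)
    rw [h0]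
    exact smul_one_mem_domL hz 2
  obtain ⟨δ, hδ, hne⟩ := ((hmem.filter_mono nhdsWithin_le_nhds).and
    (self_mem_nhdsWithin : ({0}ᶜ : Set ℂ) ∈ nhdsWithin 0 {0}ᶜ)).exists
  exact (hasDerivAt_scalarPart hf hfc hne hδ).differentiableAt

/-! ### Nilpotent matrices and properness -/

theorem nilpotent_mem_domL {t : ℂ} : (!![0, t; 0, 0] : Mat 2) ∈ domL 2 ↔ 2 * ‖t‖ ^ 2 < 1 := by
  have hU : IsUnit (!![1, t; 0, 1] : Mat 2) := by
    rw [Matrix.isUnit_iff_isUnit_det]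
    simp
  have e : (1 + !![0, t; 0, 0] + (!![0, t; 0, 0])ᴴ - (!![0, t; 0, 0])ᴴ * !![0, t; 0, 0] : Mat 2) =
      star !![1, t; 0, 1] * Matrix.diagonal ![1, ((1 - 2 * ‖t‖ ^ 2 : ℝ) : ℂ)] * !![1, t; 0, 1] := by
    have := Complex.conj_mul' t
    ext i j
    fin_cases i <;> fin_cases j <;>
      simp [Matrix.mul_apply, Fin.sum_univ_two, Matrix.star_eq_conjTranspose, this]
    ring
  rw [mem_domL_iff_posDef, e, Matrix.IsUnit.posDef_star_left_conjugate_iff hU,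
    Matrix.posDef_diagonal_iff]
  simp only [Fin.forall_fin_two, Matrix.cons_val_zero, Matrix.cons_val_one, zero_lt_one, true_and,
    Complex.zero_lt_real, sub_pos]

theorem map_nilpotent (hf : IsFreeMap domL domL f) (hfc : IsContinuous domL f)
    (h0 : ∀ n, f n 0 = 0) {t : ℂ} (ht : (!![0, t; 0, 0] : Mat 2) ∈ domL 2) :
    f 2 !![0, t; 0, 0] = !![0, t * deriv (scalarPart f) 0; 0, 0] := by
  by_cases htz : t = 0
  · have e : (!![0, 0; 0, 0] : Mat 2) = 0 := by
      ext i j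
      fin_cases i <;> fin_cases j <;> simp
    rw [htz, zero_mul, e, h0]
  have hd := (hasDerivAt_scalarPart hf hfc htz ht).deriv
  have hs : scalarPart f 0 = 0 := by simp [scalarPart, h0]
  have hcol := hf.mulVec_eigenvector ht (μ := 0) (v := ![1, 0]) (by
    funext i; fin_cases i <;> simp)
  -- The left null vector kills the bottom row of the image.
  have hrow := hf.2 1 2 0 _ !![0, 1] (zero_mem_domL 1) ht (by
    ext i j; fin_cases i; fin_cases j <;> simp [Matrix.mul_apply])
  rw [h0, Matrix.zero_mul] at hrow
  have h10 := congrFun (congrFun hrow 0) 0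
  have h11 := congrFun (congrFun hrow 0) 1
  have h00 := congrFun hcol 0
  simp [Matrix.mulVec, dotProduct, Matrix.mul_apply, hs] at h00 h10 h11
  ext i j
  fin_cases i <;> fin_cases j
  · simpa using h00
  · simp [hd]
    field_simp
  · simpa using h10.symm
  · simpa using h11.symm

/-- If `|F'(0)| < 1`, the nilpotents in the domain map into a compact subset of it, whose preimage
would then contain the boundary point with corner `1/√2`. -/
theorem one_le_norm_deriv_scalarPart (hf : IsProperContinuousFreeMap domL domL f)
    (h0 : ∀ n, f n 0 = 0) : 1 ≤ ‖deriv (scalarPart f) 0‖ := by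
  by_contra! hlt
  set d := deriv (scalarPart f) 0
  have hJ : Continuous fun t : ℂ => (!![0, t; 0, 0] : Mat 2) :=
    continuous_upperTriangular continuous_const continuous_id continuous_const
  set r : ℝ := (Real.sqrt 2)⁻¹
  have hr : 0 < r := by positivity
  have hr2 : 2 * r ^ 2 = 1 := by simp [r]
  have hmem (t : ℂ) : (!![0, t; 0, 0] : Mat 2) ∈ domL 2 ↔ ‖t‖ < r := by
    rw [nilpotent_mem_domL, ← pow_lt_pow_iff_left₀ (norm_nonneg t) hr.le two_ne_zero]
    constructor <;> intro h <;> linarith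
  have hP := hf.proper 2 ((fun t : ℂ => (!![0, t; 0, 0] : Mat 2)) '' Metric.closedBall 0 (r * ‖d‖))
    (by
      rintro _ ⟨t, ht, rfl⟩
      rw [mem_closedBall_zero_iff] at ht
      exact (hmem t).2 (ht.trans_lt (mul_lt_of_lt_one_right hr hlt)))
    ((isCompact_closedBall _ _).image hJ)
  have hcl := hP.isClosed.preimage (hJ.comp Complex.continuous_ofReal)
  have hsub : Set.Ioo 0 r ⊆ ((fun t : ℂ => (!![0, t; 0, 0] : Mat 2)) ∘ Complex.ofReal) ⁻¹'
      (domL 2 ∩ f 2 ⁻¹' ((fun t : ℂ => (!![0, t; 0, 0] : Mat 2)) ''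
        Metric.closedBall 0 (r * ‖d‖))) := by
    rintro t ⟨ht0, htr⟩
    have ht : ‖(t : ℂ)‖ < r := by rwa [Complex.norm_real, Real.norm_of_nonneg ht0.le]
    refine ⟨(hmem t).2 ht, ⟨t * d, ?_, (map_nilpotent hf.free hf.cont h0 ((hmem t).2 ht)).symm⟩⟩
    rw [mem_closedBall_zero_iff, norm_mul]
    gcongr
  have hlast := (closure_minimal hsub hcl) (by rw [closure_Ioo hr.ne]; exact ⟨hr.le, le_rfl⟩)
  have := (hmem r).1 hlast.1
  rw [Complex.norm_real, Real.norm_of_nonneg hr.le] at this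
  exact lt_irrefl _ this

/-! ### The Schwarz lemma in the coordinate `x / (1 + x)` -/

theorem norm_sub_one_lt_iff (x : ℂ) :
    ‖x - 1‖ < Real.sqrt 2 ↔ 2 * ‖x‖ ^ 2 < ‖1 + x‖ ^ 2 := by
  rw [Real.lt_sqrt (norm_nonneg _), Complex.sq_norm, Complex.sq_norm, Complex.sq_norm,
    Complex.normSq_apply, Complex.normSq_apply, Complex.normSq_apply]
  simp only [Complex.sub_re, Complex.sub_im, Complex.add_re, Complex.add_im, Complex.one_re,
    Complex.one_im]
  constructor <;> intro h <;> linarith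

theorem one_add_ne_zero_of_norm_sub_one_lt {x : ℂ} (hx : ‖x - 1‖ < Real.sqrt 2) : 1 + x ≠ 0 := by
  intro h
  rw [norm_sub_one_lt_iff, h, norm_zero] at hx
  nlinarith [sq_nonneg ‖x‖]

theorem norm_div_one_add_lt {x : ℂ} (hx : ‖x - 1‖ < Real.sqrt 2) :
    ‖x / (1 + x)‖ < (Real.sqrt 2)⁻¹ := by
  have hne := norm_pos_iff.2 (one_add_ne_zero_of_norm_sub_one_lt hx)
  rw [norm_sub_one_lt_iff] at hx
  rw [norm_div, div_lt_iff₀ hne, inv_mul_eq_div, lt_div_iff₀ (by positivity)]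
  refine lt_of_pow_lt_pow_left₀ 2 hne.le ?_
  rw [mul_pow, Real.sq_sqrt zero_le_two]
  linarith

theorem one_sub_ne_zero_of_norm_lt {y : ℂ} (hy : ‖y‖ < (Real.sqrt 2)⁻¹) : 1 - y ≠ 0 := by
  intro h
  rw [← sub_eq_zero.1 h, norm_one] at hy
  exact hy.not_ge (inv_le_one_of_one_le₀ (Real.one_le_sqrt.2 one_le_two))

theorem norm_div_one_sub_sub_one_lt {y : ℂ} (hy : ‖y‖ < (Real.sqrt 2)⁻¹) :
    ‖y / (1 - y) - 1‖ < Real.sqrt 2 := by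
  have hne := one_sub_ne_zero_of_norm_lt hy
  have e : 1 + y / (1 - y) = 1 / (1 - y) := by
    field_simp
    ring
  rw [norm_sub_one_lt_iff, e, norm_div, norm_div, norm_one, div_pow, div_pow, ← mul_div_assoc,
    one_pow]
  have hpos : 0 < ‖1 - y‖ ^ 2 := by positivity
  refine div_lt_div_of_pos_right ?_ hpos
  have := pow_lt_pow_left₀ hy (norm_nonneg y) two_ne_zero
  rw [inv_pow, Real.sq_sqrt zero_le_two] at this
  linarith

theorem exists_scalarPart_mul_eq (hf : IsProperContinuousFreeMap domL domL f)
    (h0 : ∀ n, f n 0 = 0) : ∃ θ : ℝ, ∀ x : ℂ, ‖x - 1‖ < Real.sqrt 2 →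
      scalarPart f x * (1 + x - Complex.exp (θ * Complex.I) * x) =
        Complex.exp (θ * Complex.I) * x := by
  set F := scalarPart f with hF
  have hmaps {x : ℂ} (hx : ‖x - 1‖ < Real.sqrt 2) : ‖F x - 1‖ < Real.sqrt 2 := by
    rw [← smul_one_mem_domL_one, hF, ← scalarPart_smul_one f]
    exact hf.free.1 1 (smul_one_mem_domL hx 1)
  have hF0 : F 0 = 0 := by simp [hF, scalarPart, h0]
  have hdiff {x : ℂ} (hx : ‖x - 1‖ < Real.sqrt 2) : DifferentiableAt ℂ F x :=
    differentiableAt_scalarPart hf.free hf.cont hx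
  set r : ℝ := (Real.sqrt 2)⁻¹
  have hr : 0 < r := by positivity
  -- `F` conjugated by `x ↦ x / (1 + x)`, which fixes `0` with derivative `1`, so `h'(0) = F'(0)`.
  let h : ℂ → ℂ := fun y => F (y / (1 - y)) / (1 + F (y / (1 - y)))
  have hh0 : h 0 = 0 := by simp [h, hF0]
  have hhd : DifferentiableOn ℂ h (Metric.ball 0 r) := by
    intro y hy
    rw [mem_ball_zero_iff] at hy
    have hx := norm_div_one_sub_sub_one_lt hy
    have h1 : DifferentiableAt ℂ (fun y : ℂ => y / (1 - y)) y :=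
      differentiableAt_id.div (by fun_prop) (one_sub_ne_zero_of_norm_lt hy)
    have h2 : DifferentiableAt ℂ (fun y : ℂ => F (y / (1 - y))) y :=
      DifferentiableAt.comp (g := F) y (hdiff hx) h1
    exact (h2.div (h2.const_add 1)
      (one_add_ne_zero_of_norm_sub_one_lt (hmaps hx))).differentiableWithinAt
  have hhm : Set.MapsTo h (Metric.ball 0 r) (Metric.closedBall (h 0) r) := by
    intro y hy
    rw [mem_ball_zero_iff] at hy
    rw [hh0, mem_closedBall_zero_iff]
    exact (norm_div_one_add_lt (hmaps (norm_div_one_sub_sub_one_lt hy))).le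
  have hderiv : HasDerivAt h (deriv F 0) 0 := by
    have h1 : HasDerivAt (fun y : ℂ => y / (1 - y)) 1 0 :=
      ((hasDerivAt_id (0 : ℂ)).div ((hasDerivAt_id (0 : ℂ)).const_sub 1)
        (by simp)).congr_deriv (by simp)
    have hFd : HasDerivAt F (deriv F 0) ((0 : ℂ) / (1 - 0)) := by
      rw [zero_div]
      exact (hdiff (x := 0) (by simp [Real.lt_sqrt])).hasDerivAt
    have h2 : HasDerivAt (fun y : ℂ => F (y / (1 - y))) (deriv F 0) 0 :=
      (HasDerivAt.comp (h₂ := F) 0 hFd h1).congr_deriv (mul_one _)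
    exact (h2.div (h2.const_add 1) (by simp [hF0])).congr_deriv (by simp [hF0])
  have hd1 : ‖deriv F 0‖ = 1 := by
    refine le_antisymm ?_ (one_le_norm_deriv_scalarPart hf h0)
    rw [← hderiv.deriv]
    exact Complex.norm_deriv_le_one_of_mapsTo_ball hhd hhm hr
  -- Equality in the Schwarz lemma, attained at the centre.
  have hlin := Complex.affine_of_mapsTo_ball_of_norm_dslope_eq_div hhd hhm
    (Metric.mem_ball_self hr) (by rw [dslope_same, hderiv.deriv, hd1, div_self hr.ne'])
  obtain ⟨θ, hθ⟩ := (Complex.norm_eq_one_iff _).1 hd1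
  refine ⟨θ, fun x hx => ?_⟩
  have h1x := one_add_ne_zero_of_norm_sub_one_lt hx
  have hy := hlin (mem_ball_zero_iff.2 (norm_div_one_add_lt hx))
  have hyx : x / (1 + x) / (1 - x / (1 + x)) = x := by
    have : 1 - x / (1 + x) = 1 / (1 + x) := by
      field_simp
      ring
    rw [this]
    field_simp
  have h1F := one_add_ne_zero_of_norm_sub_one_lt (hmaps hx)
  simp only [hh0, dslope_same, hderiv.deriv, ← hθ, h, hyx, zero_add, sub_zero, smul_eq_mul] at hy
  field_simp at hy
  linear_combination hy

theorem exists_eqOn_fTheta (hf : IsProperContinuousFreeMap domL domL f) (h0 : ∀ n, f n 0 = 0) :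
    ∃ θ : ℝ, ∀ n, Set.EqOn (f n) (fTheta θ n) (domL n) := by
  obtain ⟨θ, hθ⟩ := exists_scalarPart_mul_eq hf h0
  refine ⟨θ, eqOn_domL_of_eqOn_one hf.free hf.cont (isFreeMap_fTheta θ) (isContinuous_fTheta θ) ?_⟩
  intro X hX
  obtain ⟨x, rfl⟩ : ∃ x : ℂ, X = x • 1 := ⟨_, eq_smul_one X⟩
  refine (isUnit_denTheta θ hX).mul_right_cancel ?_
  rw [fTheta_mul_denTheta θ hX, scalarPart_smul_one f, smul_smul, ← hθ x (smul_one_mem_domL_one.1 hX),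
    denTheta, smul_mul_assoc, one_mul, mul_smul, smul_smul, sub_smul, add_smul, one_smul]

end FreeMap

theorem mainTheorem5 :
    -- the LMI domain is the operator-norm ball of radius `√2` around `1`
    (∀ n : ℕ, FreeMap.domL n = {X : FreeMap.Mat n | ‖X - 1‖ < Real.sqrt 2}) ∧
    -- every `f_θ` is a proper continuous free self-map
    (∀ θ : ℝ,
      (∀ (n : ℕ) (X : FreeMap.Mat n), X ∈ FreeMap.domL n → IsUnit (FreeMap.denTheta θ n X)) ∧
      FreeMap.IsProperContinuousFreeMap FreeMap.domL FreeMap.domL (FreeMap.fTheta θ) ∧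
      FreeMap.IsAnalytic FreeMap.domL (FreeMap.fTheta θ) ∧
      (∀ n : ℕ, FreeMap.fTheta θ n 0 = 0) ∧
      (∀ n : ℕ, HasFDerivAt (𝕜 := ℂ) (FreeMap.fTheta θ n)
        (Complex.exp (θ * Complex.I) • ContinuousLinearMap.id ℂ (FreeMap.Mat n)) 0)) ∧
    -- these are all the proper continuous free self-maps fixing the origin
    (∀ f : (n : ℕ) → FreeMap.Mat n → FreeMap.Mat n,
      FreeMap.IsProperContinuousFreeMap FreeMap.domL FreeMap.domL f →
      (∀ n : ℕ, f n 0 = 0) →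
      ∃ θ : ℝ, ∀ n : ℕ, Set.EqOn (f n) (FreeMap.fTheta θ n) (FreeMap.domL n)) :=
  ⟨fun _ => Set.ext fun _ => FreeMap.mem_domL_iff_norm,
    fun θ => ⟨fun _ _ hX => FreeMap.isUnit_denTheta θ hX,
      FreeMap.isProperContinuousFreeMap_fTheta θ, FreeMap.isAnalytic_fTheta θ,
      FreeMap.fTheta_zero θ, FreeMap.hasFDerivAt_fTheta_zero θ⟩,
    fun _ hf h0 => FreeMap.exists_eqOn_fTheta hf h0⟩
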